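/- Let $C\subset\mathbb R^l$ be closed, let $\bar x\in\mathbb R^n$, and let $g:\mathbb R^n\to\mathbb R^l$ satisfy $g(\bar x)\in C$ and be twice differentiable at $\bar x$, i.e. $g$ is differentiable in a neighborhood of $\bar x$ and $\nabla g$ is differentiable at $\bar x$. All spaces carry the Euclidean norm and inner product, $\mathrm{dist}(\cdot\,;\emptyset)=\infty$ and $\inf\emptyset=\infty$. For $z\in C$, let $$T_C(z)=\{u \mid \exists\, t_k\downarrow 0,\ u_k\to u:\ z+t_ku_k\in C\ \forall k\},\qquad \widehat N_C(z)=\{v\mid \langle v,u\rangle\le 0\ \ \forall u\in T_C(z)\}$$ be the contingent cone and the regular normal cone; let $$N_C(z)=\{v\mid \exists\, z_k\to z,\ v_k\to v:\ z_k\in C,\ v_k\in\widehat N_C(z_k)\ \forall k\}$$ be the limiting normal cone, with $N_C(z)=\emptyset$ for $z\notin C$; and, for a direction $w\in\mathbb R^l$, let $$N_C(z;w)=\{v\mid \exists\, t_k\downarrow 0,\ w_k\to w,\ v_k\to v:\ z+t_kw_k\in C,\ v_k\in\widehat N_C(z+t_kw_k)\ \forall k\}$$ be the limiting normal cone in direction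 $w$. For $\lambda\in\mathbb R^l$ and $v\in T_C(z)$, the lower curvature of $C$ is $$\underline\chi_C(\lambda,z;v)=\lim_{\epsilon\downarrow 0}\,\inf\Big\{\frac{\langle\lambda,v'-v\rangle}{\tau}\ \Big|\ 0<\tau<\epsilon,\ \|v'-v\|<\epsilon,\ \mathrm{dist}\big(\lambda;N_C(z+\tau v')\big)<\epsilon\Big\}\in[-\infty,\infty].$$ Assume that every pair $(u,\lambda)\in\mathbb R^n\times\mathbb R^l$ satisfying $$u\neq 0,\qquad \nabla g(\bar x)u\in T_C(g(\bar x)),$$ $$\lambda\in N_C\big(g(\bar x);\nabla g(\bar x)u\big),\qquad \nabla g(\bar x)^*\lambda=0,$$ $$\tfrac12\big\langle\nabla^2\langle\lambda,g\rangle(\bar x)u,u\big\rangle\ \ge\ \underline\chi_C\big(\lambda,g(\bar x);\nabla g(\bar x)u\big)$$ has $\lambda=0$. Then the set-valued mapping $x\mapsto g(x)-C$ is metrically subregular at $(\bar x,0)$: there are $\kappa\ge 0$ and a neighborhood $U$ of $\bar x$ such that $$\mathrm{dist}\big(x;g^{-1}(C)\big)\le\kappa\,\mathrm{dist}\big(g(x);C\big)\quad\text{for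 all }x\in U.$$ -/

import Mathlib

open Filter Topology

namespace VarAnalysis

section Cones

variable {E : Type*} [NormedAddCommGroup E] [InnerProductSpace ℝ E]

/-- The (Bouligand-Severi) contingent cone `T_Ω(z)`: limits of `u k` along which
`z + t k • u k ∈ Ω` for some positive `t k → 0`. -/
def contingentCone (Ω : Set E) (z : E) : Set E :=
  {u | ∃ (t : ℕ → ℝ) (u' : ℕ → E),
    (∀ k, 0 < t k) ∧ Tendsto t atTop (𝓝 0) ∧ Tendsto u' atTop (𝓝 u) ∧
    ∀ k, z + t k • u' k ∈ Ω}

/-- The (Fréchet) regular normal cone `T_Ω(z)^*`, the polar of the contingent cone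
(meant for `z ∈ Ω`). -/
def regularNormalCone (Ω : Set E) (z : E) : Set E :=
  {v | ∀ u ∈ contingentCone Ω z, inner ℝ v u ≤ 0}

/-- The (Mordukhovich) limiting normal cone `N_Ω(z)`, empty when `z ∉ Ω`. -/
def limitingNormalCone (Ω : Set E) (z : E) : Set E :=
  {v | z ∈ Ω ∧ ∃ (z' v' : ℕ → E),
    Tendsto z' atTop (𝓝 z) ∧ Tendsto v' atTop (𝓝 v) ∧
    ∀ k, z' k ∈ Ω ∧ v' k ∈ regularNormalCone Ω (z' k)}

/-- The limiting normal cone `N_Ω(z; w)` to `Ω` at `z` in direction `w`. -/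
def directionalNormalCone (Ω : Set E) (z w : E) : Set E :=
  {v | ∃ (t : ℕ → ℝ) (w' v' : ℕ → E),
    (∀ k, 0 < t k) ∧ Tendsto t atTop (𝓝 0) ∧
    Tendsto w' atTop (𝓝 w) ∧ Tendsto v' atTop (𝓝 v) ∧
    ∀ k, z + t k • w' k ∈ Ω ∧ v' k ∈ regularNormalCone Ω (z + t k • w' k)}

/-- For `ε > 0`, the infimum (in `[-∞, ∞]`, with `inf ∅ = ∞`) of `⟨lam, v' - v⟩ / τ` over all
`0 < τ < ε` and `v'` with `‖v' - v‖ < ε` and `dist (lam; N_Ω(z + τ v')) < ε`.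
The distance to the empty set is `∞`. -/
noncomputable def lowerCurvatureAux (Ω : Set E) (lam z v : E) (ε : ℝ) : EReal :=
  sInf {r : EReal | ∃ (τ : ℝ) (v' : E), 0 < τ ∧ τ < ε ∧ ‖v' - v‖ < ε ∧
    Metric.infEDist lam (limitingNormalCone Ω (z + τ • v')) < ENNReal.ofReal ε ∧
    r = ((inner ℝ lam (v' - v) / τ : ℝ) : EReal)}

/-- The (directional) lower curvature of `Ω` at `z` in direction `v` for the multiplier `lam`:
the limit of `lowerCurvatureAux Ω lam z v ε` as `ε ↓ 0`. Since that quantity increases as `ε`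
decreases, the limit is the supremum over `ε > 0`. -/
noncomputable def lowerCurvature (Ω : Set E) (lam z v : E) : EReal :=
  ⨆ (ε : ℝ) (_ : 0 < ε), lowerCurvatureAux Ω lam z v ε

theorem lowerCurvatureAux_antitone (Ω : Set E) (lam z v : E) :
    Antitone (lowerCurvatureAux Ω lam z v) := by
  intro a b hab
  apply sInf_le_sInf
  rintro r ⟨τ, v', h0, h1, h2, h3, rfl⟩
  exact ⟨τ, v', h0, h1.trans_le hab, h2.trans_le hab,
    h3.trans_le (ENNReal.ofReal_le_ofReal hab), rfl⟩

theorem tendsto_lowerCurvatureAux (Ω : Set E) (lam z v : E) :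
    Tendsto (lowerCurvatureAux Ω lam z v) (𝓝[>] 0) (𝓝 (lowerCurvature Ω lam z v)) := by
  have h := (lowerCurvatureAux_antitone Ω lam z v).tendsto_nhdsGT 0
  rwa [sSup_image] at h

end Cones

/-- `f` is twice differentiable at `x`: it is differentiable near `x` and its derivative is
differentiable at `x`. -/
def TwiceDifferentiableAt {E F : Type*} [NormedAddCommGroup E] [NormedSpace ℝ E]
    [NormedAddCommGroup F] [NormedSpace ℝ F] (f : E → F) (x : E) : Prop :=
  (∀ᶠ y in 𝓝 x, DifferentiableAt ℝ f y) ∧ DifferentiableAt ℝ (fderiv ℝ f) x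

/-- Metric subregularity of the set-valued mapping `F` at a point `(z₀, y₀)` of its graph:
`dist (z; F⁻¹(y₀)) ≤ κ dist (y₀; F(z))` for all `z` near `z₀`, with some `κ ≥ 0`.
The distance to the empty set is `∞`. -/
def MetricallySubregularAt {Z Y : Type*} [PseudoMetricSpace Z] [PseudoMetricSpace Y]
    (F : Z → Set Y) (z₀ : Z) (y₀ : Y) : Prop :=
  y₀ ∈ F z₀ ∧ ∃ κ : NNReal, ∀ᶠ z in 𝓝 z₀,
    Metric.infEDist z {z' | y₀ ∈ F z'} ≤ (κ : ENNReal) * Metric.infEDist y₀ (F z)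

end VarAnalysis

open Asymptotics

namespace VarAnalysis

section Proximal

variable {E : Type*} [NormedAddCommGroup E] [InnerProductSpace ℝ E]

/-! Argue by contradiction. If subregularity fails, minimizing `dist (g x; C) + δ ‖x - x₁‖` near a
badly violating point `x₁` (Ekeland's principle, with compactness giving the minimizer) yields
infeasible `x k → x₀` with projections `z k`, residuals `o(‖x k - x₀‖)`, and unit proximal normals
`L k` at `z k` that the adjoint derivatives send to `0`; see
`exists_approx_stationary_of_not_subregular`. Along a subsequence `L k → lam` and the normalized `x
k - x₀` converge to `u`, both of norm one. Writing `z k = g x₀ + t k • w k` with `t k = ‖x k - x₀‖`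
gives `w k → A u`, where `A` is the derivative at `x₀`; this yields all first-order conditions on
`(u, lam)`. As `lam` annihilates the range of `A`, the quotient `⟨lam, w k - A u⟩ / t k` is `⟨lam, g
(x k) - g x₀⟩ / t k ^ 2` minus a residual term that is eventually nonnegative. By Taylor the former
tends to half the quadratic form, which therefore bounds the lower curvature. The hypothesis forces
`lam = 0`, against `‖lam‖ = 1`. -/

/-! ### Proximal normals, approximate stationarity and curvature bounds. -/

theorem smul_sub_mem_regularNormalCone {Ω : Set E} {p z : E}
    (hmin : ∀ c ∈ Ω, ‖p - z‖ ≤ ‖p - c‖) {a : ℝ} (ha : 0 ≤ a) :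
    a • (p - z) ∈ regularNormalCone Ω z := by
  rintro u ⟨t, u', ht, ht0, hu', hmem⟩
  -- Expanding the square leaves an error of order `t k`, which vanishes in the limit.
  have key : ∀ k, inner ℝ (p - z) (u' k) ≤ t k / 2 * ‖u' k‖ ^ 2 := by
    intro k
    have h1 := hmin _ (hmem k)
    have h2 : ‖p - z‖ ^ 2 ≤ ‖(p - z) - t k • u' k‖ ^ 2 := by
      rw [sub_sub]
      gcongr
    rw [norm_sub_sq_real (p - z), inner_smul_right, norm_smul, Real.norm_eq_abs, mul_pow, sq_abs] at h2
    have h3 : t k * inner ℝ (p - z) (u' k) ≤ t k * (t k / 2 * ‖u' k‖ ^ 2) := by linarith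
    exact le_of_mul_le_mul_left h3 (ht k)
  have hl : Tendsto (fun k => inner ℝ (p - z) (u' k)) atTop (𝓝 (inner ℝ (p - z) u)) :=
    tendsto_const_nhds.inner hu'
  have hr : Tendsto (fun k => t k / 2 * ‖u' k‖ ^ 2) atTop (𝓝 (0 / 2 * ‖u‖ ^ 2)) :=
    (ht0.div_const 2).mul (hu'.norm.pow 2)
  have h := le_of_tendsto_of_tendsto' hl hr key
  rw [real_inner_smul_left]
  exact mul_nonpos_of_nonneg_of_nonpos ha (by simpa using h)

theorem neg_mul_norm_le_fderiv_of_isLocalMin {F : Type*} [NormedAddCommGroup F] [NormedSpace ℝ F]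
    {h : F → ℝ} {h' : F →L[ℝ] ℝ} {x : F} {c : ℝ} (hh : HasFDerivAt h h' x)
    (hmin : ∀ᶠ y in 𝓝 x, h x ≤ h y + c * ‖y - x‖) (d : F) : -(c * ‖d‖) ≤ h' d := by
  have h1 : HasDerivAt (fun t : ℝ => x + t • d) d 0 := by
    simpa using ((hasDerivAt_id (0 : ℝ)).smul_const d).const_add x
  have h2 : HasDerivAt (fun t : ℝ => h (x + t • d)) (h' d) 0 := by
    have : HasFDerivAt h h' (x + (0 : ℝ) • d) := by simpa using hh
    exact this.comp_hasDerivAt (0 : ℝ) h1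
  have h3 := h2.tendsto_slope_zero_right
  have h4 : Tendsto (fun t : ℝ => x + t • d) (𝓝[>] 0) (𝓝 x) := by
    have := h1.continuousAt.tendsto
    simp only [zero_smul, add_zero] at this
    exact this.mono_left nhdsWithin_le_nhds
  refine ge_of_tendsto h3 ?_
  filter_upwards [h4.eventually hmin, self_mem_nhdsWithin] with t ht ht0
  have ht0 : 0 < t := ht0
  simp only [add_sub_cancel_left, norm_smul, Real.norm_eq_abs, abs_of_pos ht0] at ht
  simp only [zero_add, zero_smul, add_zero, smul_eq_mul]
  rw [← div_eq_inv_mul, le_div_iff₀ ht0]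
  linarith

/-- Away from its zeros the norm is smooth, so `‖g · - z‖` has gradient `a` at `x`; testing the
approximate Fermat rule in direction `-a` gives `‖a‖ ^ 2 ≤ c * ‖a‖`. -/
theorem norm_adjoint_le_of_isLocalMin {F : Type*} [NormedAddCommGroup F] [InnerProductSpace ℝ F]
    [CompleteSpace E] [CompleteSpace F] {g : F → E} {x : F} {z : E} {c : ℝ}
    (hg : DifferentiableAt ℝ g x) (hz : g x ≠ z) (hc : 0 ≤ c)
    (hmin : ∀ᶠ y in 𝓝 x, ‖g x - z‖ ≤ ‖g y - z‖ + c * ‖y - x‖) :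
    ‖ContinuousLinearMap.adjoint (fderiv ℝ g x) (‖g x - z‖⁻¹ • (g x - z))‖ ≤ c := by
  set lam := ‖g x - z‖⁻¹ • (g x - z) with hlam
  set a := ContinuousLinearMap.adjoint (fderiv ℝ g x) lam with ha
  have hne : g x - z ≠ 0 := sub_ne_zero.mpr hz
  have hlin : ∀ d, inner ℝ lam (fderiv ℝ g x d) = inner ℝ a d := fun d => by
    rw [ha, ContinuousLinearMap.adjoint_inner_left]
  have hd : HasFDerivAt (fun y => ‖g y - z‖) (innerSL ℝ a) x := by
    have h1 := (hg.hasFDerivAt.sub_const z).norm_sq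
    have h2 := h1.sqrt (by simpa using hne)
    have h3 : (fun y => √(‖g y - z‖ ^ 2)) = fun y => ‖g y - z‖ := by
      funext y; exact Real.sqrt_sq (norm_nonneg _)
    rw [h3] at h2
    refine h2.congr_fderiv ?_
    ext d
    rw [innerSL_apply_apply, ← hlin, hlam]
    have hn : ‖g x - z‖ ≠ 0 := norm_ne_zero_iff.mpr hne
    simp only [Real.sqrt_sq (norm_nonneg _), real_inner_smul_left, smul_apply,
      ContinuousLinearMap.comp_apply, innerSL_apply_apply, smul_eq_mul, nsmul_eq_mul]
    push_cast
    field_simp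
  have h := neg_mul_norm_le_fderiv_of_isLocalMin hd hmin (-a)
  rw [norm_neg, innerSL_apply_apply, inner_neg_right, real_inner_self_eq_norm_sq] at h
  by_contra! hlt
  nlinarith [norm_nonneg a]

theorem regularNormalCone_subset_limitingNormalCone {Ω : Set E} {z : E} (hz : z ∈ Ω) :
    regularNormalCone Ω z ⊆ limitingNormalCone Ω z := by
  intro v hv
  exact ⟨hz, fun _ => z, fun _ => v, tendsto_const_nhds, tendsto_const_nhds, fun _ => ⟨hz, hv⟩⟩

/-- The curvature only asks `lam` to be close to the normal cones at nearby points, so normals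
converging to `lam` suffice. -/
theorem lowerCurvature_le_of_tendsto {Ω : Set E} {lam z v : E} {t : ℕ → ℝ} {w lam' : ℕ → E}
    {s : ℕ → ℝ} {q : ℝ} (ht : ∀ k, 0 < t k) (ht0 : Tendsto t atTop (𝓝 0))
    (hw : Tendsto w atTop (𝓝 v)) (hlam : Tendsto lam' atTop (𝓝 lam))
    (hmem : ∀ k, lam' k ∈ limitingNormalCone Ω (z + t k • w k))
    (hle : ∀ᶠ k in atTop, inner ℝ lam (w k - v) / t k ≤ s k) (hs : Tendsto s atTop (𝓝 q)) :
    lowerCurvature Ω lam z v ≤ q := by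
  rw [lowerCurvature, iSup₂_le_iff]
  intro ε hε
  have hs' : Tendsto (fun k => (s k : EReal)) atTop (𝓝 q) :=
    (continuous_coe_real_ereal.tendsto q).comp hs
  refine ge_of_tendsto hs' ?_
  filter_upwards [hle, ht0.eventually_lt_const hε, hw.eventually (Metric.ball_mem_nhds v hε),
    hlam.eventually (Metric.ball_mem_nhds lam hε)] with k h1 h2 h3 h4
  refine le_trans ?_ (EReal.coe_le_coe_iff.mpr h1)
  rw [lowerCurvatureAux]
  refine sInf_le ⟨t k, w k, ht k, h2, ?_, ?_, rfl⟩
  · rwa [← dist_eq_norm]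
  · refine (Metric.infEDist_le_edist_of_mem (hmem k)).trans_lt ?_
    rw [edist_comm, edist_dist]
    exact (ENNReal.ofReal_lt_ofReal_iff hε).mpr h4

theorem TwiceDifferentiableAt.const_inner {F : Type*} [NormedAddCommGroup F] [NormedSpace ℝ F]
    {g : F → E} {x₀ : F} (hg : TwiceDifferentiableAt g x₀) (lam : E) :
    TwiceDifferentiableAt (fun x => inner ℝ lam (g x)) x₀ := by
  have h : ∀ᶠ x in 𝓝 x₀,
      HasFDerivAt (fun x => inner ℝ lam (g x)) ((innerSL ℝ lam).comp (fderiv ℝ g x)) x := by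
    filter_upwards [hg.1] with x hx
    exact (innerSL ℝ lam).hasFDerivAt.comp x hx.hasFDerivAt
  refine ⟨h.mono fun x hx => hx.differentiableAt, ?_⟩
  have h2 : DifferentiableAt ℝ (fun x => (innerSL ℝ lam).comp (fderiv ℝ g x)) x₀ :=
    (differentiableAt_const _).clm_comp hg.2
  exact h2.congr_of_eventuallyEq (h.mono fun x hx => hx.fderiv)

end Proximal

/-! ### Second-order Taylor expansion. -/

theorem tendsto_clm_apply {α F G : Type*} [NormedAddCommGroup F] [NormedSpace ℝ F]
    [NormedAddCommGroup G] [NormedSpace ℝ G] {f : Filter α} {T : α → F →L[ℝ] G} {T₀ : F →L[ℝ] G}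
    {y : α → F} {y₀ : F} (hT : Tendsto T f (𝓝 T₀)) (hy : Tendsto y f (𝓝 y₀)) :
    Tendsto (fun a => T a (y a)) f (𝓝 (T₀ y₀)) :=
  (isBoundedBilinearMap_apply.continuous.tendsto (T₀, y₀)).comp (hT.prodMk_nhds hy)

/-- Without continuity of the second derivative, the mean value theorem along the segment reduces
the claim to differentiability of `fderiv ℝ φ` at `x₀`. -/
theorem TwiceDifferentiableAt.isLittleO_taylor {F : Type*} [NormedAddCommGroup F]
    [NormedSpace ℝ F] {φ : F → ℝ} {x₀ : F} (hφ : TwiceDifferentiableAt φ x₀) :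
    (fun x => φ x - φ x₀ - fderiv ℝ φ x₀ (x - x₀)
      - 1 / 2 * fderiv ℝ (fderiv ℝ φ) x₀ (x - x₀) (x - x₀)) =o[𝓝 x₀] fun x => ‖x - x₀‖ ^ 2 := by
  rw [isLittleO_iff]
  intro c hc
  have h1 := hφ.2.hasFDerivAt.isLittleO.def hc
  obtain ⟨δ, hδ, hball⟩ := Metric.eventually_nhds_iff_ball.mp (hφ.1.and h1)
  filter_upwards [Metric.ball_mem_nhds x₀ hδ] with x hx
  set d := x - x₀ with hd
  have hseg : ∀ s ∈ Set.Icc (0 : ℝ) 1, x₀ + s • d ∈ Metric.ball x₀ δ := by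
    intro s hs
    rw [mem_ball_iff_norm, add_sub_cancel_left, norm_smul, Real.norm_eq_abs, abs_of_nonneg hs.1]
    rw [mem_ball_iff_norm] at hx
    exact (mul_le_of_le_one_left (norm_nonneg _) hs.2).trans_lt hx
  -- Chosen so that `ψ 1 - ψ 0` is the Taylor remainder.
  set ψ : ℝ → ℝ := fun s => φ (x₀ + s • d) - s * fderiv ℝ φ x₀ d
    - s ^ 2 / 2 * fderiv ℝ (fderiv ℝ φ) x₀ d d with hψ
  have hder : ∀ s ∈ Set.Icc (0 : ℝ) 1, HasDerivAt ψ (fderiv ℝ φ (x₀ + s • d) d - fderiv ℝ φ x₀ d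
      - s * fderiv ℝ (fderiv ℝ φ) x₀ d d) s := by
    intro s hs
    have e1 : HasDerivAt (fun t : ℝ => x₀ + t • d) d s := by
      simpa using ((hasDerivAt_id s).smul_const d).const_add x₀
    have e2 : HasDerivAt (fun t : ℝ => φ (x₀ + t • d)) (fderiv ℝ φ (x₀ + s • d) d) s :=
      (hball _ (hseg s hs)).1.hasFDerivAt.comp_hasDerivAt s e1
    have e3 := (hasDerivAt_id s).mul_const (fderiv ℝ φ x₀ d)
    have e4 := (((hasDerivAt_id s).pow 2).div_const 2).mul_const (fderiv ℝ (fderiv ℝ φ) x₀ d d)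
    refine ((e2.sub e3).sub e4).congr_deriv ?_
    simp
  obtain ⟨s, hs, hslope⟩ := exists_hasDerivAt_eq_slope ψ _ one_pos
    (fun s hs => (hder s hs).continuousAt.continuousWithinAt)
    (fun s hs => hder s (Set.Ioo_subset_Icc_self hs))
  have hs' := Set.Ioo_subset_Icc_self hs
  have hb := (hball _ (hseg s hs')).2
  have hval : φ x - φ x₀ - fderiv ℝ φ x₀ d - 1 / 2 * fderiv ℝ (fderiv ℝ φ) x₀ d d =
      (fderiv ℝ φ (x₀ + s • d) - fderiv ℝ φ x₀ - fderiv ℝ (fderiv ℝ φ) x₀ (s • d)) d := by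
    have hx1 : x₀ + d = x := by rw [hd]; abel
    simp only [hψ, one_smul, zero_smul, add_zero, hx1] at hslope
    simp only [sub_apply, map_smul, smul_apply, smul_eq_mul]
    linarith
  rw [hval]
  rw [add_sub_cancel_left] at hb
  have hsd : ‖s • d‖ ≤ ‖d‖ := by
    rw [norm_smul, Real.norm_eq_abs, abs_of_nonneg hs'.1]
    exact mul_le_of_le_one_left (norm_nonneg _) hs'.2
  calc _ ≤ ‖fderiv ℝ φ (x₀ + s • d) - fderiv ℝ φ x₀ - fderiv ℝ (fderiv ℝ φ) x₀ (s • d)‖ * ‖d‖ :=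
        ContinuousLinearMap.le_opNorm _ _
    _ ≤ (c * ‖d‖) * ‖d‖ := by
        gcongr
        exact hb.trans (by gcongr)
    _ = c * ‖‖d‖ ^ 2‖ := by rw [Real.norm_eq_abs, abs_of_nonneg (by positivity)]; ring

/-! ### Consequences of failed subregularity. -/

theorem metricallySubregularAt_constraint_iff {Z E : Type*} [PseudoMetricSpace Z]
    [NormedAddCommGroup E] {g : Z → E} {C : Set E} {x₀ : Z} (hx₀ : g x₀ ∈ C) :
    MetricallySubregularAt (fun x => (fun c => g x - c) '' C) x₀ 0 ↔
      ∃ κ : NNReal, ∀ᶠ x in 𝓝 x₀,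
        Metric.infDist x (g ⁻¹' C) ≤ κ * Metric.infDist (g x) C := by
  have hpre : {x | (0 : E) ∈ (fun c => g x - c) '' C} = g ⁻¹' C := by
    ext x
    simp only [Set.mem_ofPred_eq, Set.mem_image, Set.mem_preimage, sub_eq_zero]
    exact ⟨fun ⟨c, hc, h⟩ => h ▸ hc, fun h => ⟨_, h, rfl⟩⟩
  have himg : ∀ x, Metric.infEDist (0 : E) ((fun c => g x - c) '' C) = Metric.infEDist (g x) C := by
    intro x
    have : Isometry fun c : E => g x - c := IsometryEquiv.subLeft (g x) |>.isometry
    conv_lhs => rw [← sub_self (g x)]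
    exact Metric.infEDist_image this
  unfold MetricallySubregularAt
  simp only [hpre, himg]
  have h0 : (0 : E) ∈ (fun c => g x₀ - c) '' C := ⟨g x₀, hx₀, sub_self _⟩
  rw [and_iff_right h0]
  refine exists_congr fun κ => Filter.eventually_congr (Eventually.of_forall fun x => ?_)
  have hf1 : Metric.infEDist x (g ⁻¹' C) ≠ ⊤ := Metric.infEDist_ne_top ⟨x₀, hx₀⟩
  have hf2 : Metric.infEDist (g x) C ≠ ⊤ := Metric.infEDist_ne_top ⟨_, hx₀⟩
  rw [← ENNReal.toReal_le_toReal hf1 (ENNReal.mul_ne_top ENNReal.coe_ne_top hf2),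
    ENNReal.toReal_mul]
  rfl

/-- Failure of metric subregularity of `x ↦ g x - C` yields approximately stationary infeasible
points of the distance `x ↦ dist (g x; C)`, together with proximal normals to `C`. -/
theorem exists_approx_stationary_of_not_subregular {E F : Type*}
    [NormedAddCommGroup E] [InnerProductSpace ℝ E] [ProperSpace E]
    [NormedAddCommGroup F] [InnerProductSpace ℝ F] [ProperSpace F]
    {g : F → E} {C : Set E} (hC : IsClosed C) {x₀ : F} (hx₀ : g x₀ ∈ C)
    (hg : ∀ᶠ x in 𝓝 x₀, DifferentiableAt ℝ g x)
    (hnot : ¬ MetricallySubregularAt (fun x => (fun c => g x - c) '' C) x₀ 0)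
    {δ : ℝ} (hδ : 0 < δ) :
    ∃ (x : F) (z : E), x ≠ x₀ ∧ ‖x - x₀‖ < δ ∧ z ∈ C ∧ g x ≠ z ∧
      ‖g x - z‖ ≤ δ * ‖x - x₀‖ ∧ ‖g x - z‖⁻¹ • (g x - z) ∈ regularNormalCone C z ∧
      ‖ContinuousLinearMap.adjoint (fderiv ℝ g x) (‖g x - z‖⁻¹ • (g x - z))‖ ≤ δ := by
  rw [metricallySubregularAt_constraint_iff hx₀] at hnot
  push Not at hnot
  obtain ⟨ρ, hρ, hball⟩ := Metric.eventually_nhds_iff_ball.mp hg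
  -- The minimization runs over the closed ball of radius `2 * r`: `δ / 2` keeps its points within
  -- `δ` of `x₀`, and `ρ / 3` keeps it where `g` is differentiable.
  set r : ℝ := min (δ / 2) (ρ / 3) with hr
  have hr0 : 0 < r := by positivity
  obtain ⟨x₁, hx₁, hx₁r⟩ := ((hnot (Real.toNNReal (2 / δ))).and_eventually
    (Metric.ball_mem_nhds x₀ hr0)).exists
  rw [Real.coe_toNNReal _ (by positivity)] at hx₁
  set f : F → ℝ := fun x => Metric.infDist (g x) C with hf
  have hx₁r : ‖x₁ - x₀‖ < r := by rwa [← dist_eq_norm]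
  have hfx₁ : 2 / δ * f x₁ < Metric.infDist x₁ (g ⁻¹' C) := hx₁
  have hdle : Metric.infDist x₁ (g ⁻¹' C) ≤ ‖x₁ - x₀‖ := by
    rw [← dist_eq_norm]
    exact Metric.infDist_le_dist_of_mem hx₀
  have hsub : Metric.closedBall x₀ (2 * r) ⊆ Metric.ball x₀ ρ := by
    apply Metric.closedBall_subset_ball
    have := min_le_right (δ / 2) (ρ / 3)
    linarith
  have hcont : ContinuousOn (fun x => f x + δ * ‖x - x₁‖) (Metric.closedBall x₀ (2 * r)) := by
    intro x hx
    have h1 : ContinuousAt f x :=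
      (Metric.continuous_infDist_pt C).continuousAt.comp (hball x (hsub hx)).continuousAt
    exact (h1.add (by fun_prop)).continuousWithinAt
  have hx₁mem : x₁ ∈ Metric.closedBall x₀ (2 * r) := by
    rw [mem_closedBall_iff_norm]; linarith
  obtain ⟨x, hx, hmin⟩ := (isCompact_closedBall x₀ (2 * r)).exists_isMinOn ⟨x₁, hx₁mem⟩ hcont
  have hle : f x + δ * ‖x - x₁‖ ≤ f x₁ := by simpa using hmin hx₁mem
  have hf0 : ∀ y, 0 ≤ f y := fun y => Metric.infDist_nonneg
  have hfx₁' : f x₁ < δ / 2 * Metric.infDist x₁ (g ⁻¹' C) := by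
    have := mul_lt_mul_of_pos_left hfx₁ (show 0 < δ / 2 by positivity)
    field_simp at this ⊢
    linarith
  -- The constant `2 / δ` was chosen for this factor `1 / 2`: it makes `x` infeasible, interior to
  -- the ball, and no closer to `x₀` than half the distance from `x₁` to the feasible set.
  have hdist : ‖x - x₁‖ < Metric.infDist x₁ (g ⁻¹' C) / 2 := by
    have : δ * ‖x - x₁‖ < δ * (Metric.infDist x₁ (g ⁻¹' C) / 2) := by linarith [hf0 x]
    exact lt_of_mul_lt_mul_left this hδ.le
  have hnx : ‖x₁ - x₀‖ ≤ ‖x - x₁‖ + ‖x - x₀‖ := by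
    rw [norm_sub_rev x x₁]; exact norm_sub_le_norm_sub_add_norm_sub _ _ _
  have hnx' : ‖x - x₀‖ ≤ ‖x - x₁‖ + ‖x₁ - x₀‖ := norm_sub_le_norm_sub_add_norm_sub _ _ _
  have hr1 : r ≤ δ / 2 := min_le_left _ _
  have hxC : g x ∉ C := by
    intro h
    have h1 : Metric.infDist x₁ (g ⁻¹' C) ≤ ‖x - x₁‖ := by
      rw [norm_sub_rev, ← dist_eq_norm]
      exact Metric.infDist_le_dist_of_mem h
    linarith [norm_nonneg (x - x₁)]
  obtain ⟨z, hz, hzd⟩ := hC.exists_infDist_eq_dist ⟨_, hx₀⟩ (g x)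
  have hfz : f x = ‖g x - z‖ := by rw [← dist_eq_norm]; exact hzd
  have hne : g x ≠ z := fun h => hxC (h ▸ hz)
  have hfle : ∀ y, ∀ c ∈ C, f y ≤ ‖g y - c‖ := fun y c hc => by
    rw [← dist_eq_norm]; exact Metric.infDist_le_dist_of_mem hc
  refine ⟨x, z, fun h => hxC (h ▸ hx₀), by linarith, hz, hne, ?_, ?_, ?_⟩
  · rw [← hfz]
    have h1 : f x ≤ δ / 2 * Metric.infDist x₁ (g ⁻¹' C) := by
      linarith [mul_nonneg hδ.le (norm_nonneg (x - x₁))]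
    have h2 : Metric.infDist x₁ (g ⁻¹' C) ≤ 2 * ‖x - x₀‖ := by linarith
    calc f x ≤ δ / 2 * (2 * ‖x - x₀‖) := h1.trans (by gcongr)
      _ = δ * ‖x - x₀‖ := by ring
  · exact smul_sub_mem_regularNormalCone (fun c hc => hfz ▸ hfle x c hc) (by positivity)
  -- Freezing the projection `z` replaces the nonsmooth `f` by the majorant `‖g · - z‖`, which
  -- agrees with it at `x`.
  · refine norm_adjoint_le_of_isLocalMin (hball x (hsub hx)) hne hδ.le ?_
    have hxint : x ∈ Metric.ball x₀ (2 * r) := by rw [mem_ball_iff_norm]; linarith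
    filter_upwards [Metric.isOpen_ball.mem_nhds hxint] with y hy
    have h1 : f x + δ * ‖x - x₁‖ ≤ f y + δ * ‖y - x₁‖ := hmin (Metric.ball_subset_closedBall hy)
    have h2 : δ * ‖y - x₁‖ ≤ δ * (‖y - x‖ + ‖x - x₁‖) := by
      gcongr; exact norm_sub_le_norm_sub_add_norm_sub _ _ _
    have h3 := hfle y z hz
    rw [← hfz]
    linarith

end VarAnalysis

/-! ### Passage to the limit and the second-order contradiction. -/

theorem corollary4p6 (n l : ℕ)
    (g : EuclideanSpace ℝ (Fin n) → EuclideanSpace ℝ (Fin l))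
    (C : Set (EuclideanSpace ℝ (Fin l))) (hC : IsClosed C)
    (x₀ : EuclideanSpace ℝ (Fin n)) (hx₀ : g x₀ ∈ C)
    (hg : VarAnalysis.TwiceDifferentiableAt g x₀)
    (hsecond : ∀ (u : EuclideanSpace ℝ (Fin n)) (lam : EuclideanSpace ℝ (Fin l)),
      u ≠ 0 →
      fderiv ℝ g x₀ u ∈ VarAnalysis.contingentCone C (g x₀) →
      lam ∈ VarAnalysis.directionalNormalCone C (g x₀) (fderiv ℝ g x₀ u) →
      ContinuousLinearMap.adjoint (fderiv ℝ g x₀) lam = 0 →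
      (((1 / 2 : ℝ) * fderiv ℝ (fderiv ℝ (fun x => inner ℝ lam (g x))) x₀ u u : ℝ) : EReal) ≥
        VarAnalysis.lowerCurvature C lam (g x₀) (fderiv ℝ g x₀ u) →
      lam = 0) :
    VarAnalysis.MetricallySubregularAt (fun x => (fun c => g x - c) '' C) x₀ 0 := by
  by_contra hnot
  have hpos : ∀ k : ℕ, (0 : ℝ) < 1 / ((k : ℝ) + 1) := fun k => Nat.one_div_pos_of_nat
  choose x z hne hxlt hzC hgz hgzle hreg hadj using fun k : ℕ =>
    VarAnalysis.exists_approx_stationary_of_not_subregular hC hx₀ hg.1 hnot (hpos k)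
  have hδ : Tendsto (fun k : ℕ => 1 / ((k : ℝ) + 1)) atTop (𝓝 0) :=
    tendsto_one_div_add_atTop_nhds_zero_nat
  set L : ℕ → EuclideanSpace ℝ (Fin l) := fun k => ‖g (x k) - z k‖⁻¹ • (g (x k) - z k) with hL
  set U : ℕ → EuclideanSpace ℝ (Fin n) := fun k => ‖x k - x₀‖⁻¹ • (x k - x₀) with hU
  have hLnorm : ∀ k, L k ∈ Metric.sphere (0 : EuclideanSpace ℝ (Fin l)) 1 := fun k => by
    rw [mem_sphere_zero_iff_norm]
    exact norm_smul_inv_norm (𝕜 := ℝ) (sub_ne_zero.mpr (hgz k))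
  have hUnorm : ∀ k, U k ∈ Metric.sphere (0 : EuclideanSpace ℝ (Fin n)) 1 := fun k => by
    rw [mem_sphere_zero_iff_norm]
    exact norm_smul_inv_norm (𝕜 := ℝ) (sub_ne_zero.mpr (hne k))
  obtain ⟨⟨lam, u⟩, hlu, σ, hσ, hlim⟩ :=
    ((isCompact_sphere _ _).prod (isCompact_sphere _ _)).tendsto_subseq (x := fun k => (L k, U k)) (fun k => ⟨hLnorm k, hUnorm k⟩)
  rw [Prod.tendsto_iff] at hlim
  obtain ⟨hlimL, hlimU⟩ := hlim
  have hlimL : Tendsto (fun k => L (σ k)) atTop (𝓝 lam) := hlimL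
  have hlimU : Tendsto (fun k => U (σ k)) atTop (𝓝 u) := hlimU
  have hlam1 : ‖lam‖ = 1 := mem_sphere_zero_iff_norm.mp hlu.1
  have hu1 : ‖u‖ = 1 := mem_sphere_zero_iff_norm.mp hlu.2
  set A := fderiv ℝ g x₀ with hA
  set t : ℕ → ℝ := fun k => ‖x (σ k) - x₀‖ with ht
  have htpos : ∀ k, 0 < t k := fun k => norm_pos_iff.mpr (sub_ne_zero.mpr (hne _))
  have hδσ : Tendsto (fun k => 1 / ((σ k : ℝ) + 1)) atTop (𝓝 0) := hδ.comp hσ.tendsto_atTop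
  have ht0 : Tendsto t atTop (𝓝 0) :=
    squeeze_zero (fun k => (htpos k).le) (fun k => (hxlt (σ k)).le) hδσ
  have hx : Tendsto (fun k => x (σ k)) atTop (𝓝 x₀) := tendsto_iff_norm_sub_tendsto_zero.mpr ht0
  have hxU : ∀ k, x (σ k) - x₀ = t k • U (σ k) := fun k =>
    (smul_inv_smul₀ (htpos k).ne' _).symm
  have hzL : ∀ k, z (σ k) = g (x (σ k)) - ‖g (x (σ k)) - z (σ k)‖ • L (σ k) := fun k => by
    rw [hL, smul_inv_smul₀ (norm_ne_zero_iff.mpr (sub_ne_zero.mpr (hgz _))), sub_sub_cancel]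
  set w : ℕ → EuclideanSpace ℝ (Fin l) := fun k => (t k)⁻¹ • (z (σ k) - g x₀) with hw
  have hzw : ∀ k, g x₀ + t k • w k = z (σ k) := fun k => by
    rw [hw, smul_inv_smul₀ (htpos k).ne']; abel
  -- `w k` splits into the linearization error, `A (U (σ k))`, and the scaled residual.
  have hwlim : Tendsto w atTop (𝓝 (A u)) := by
    have h1 : Tendsto (fun k => (t k)⁻¹ • (g (x (σ k)) - g x₀ - A (x (σ k) - x₀)))
        atTop (𝓝 0) := by
      have := (hg.1.self_of_nhds.hasFDerivAt.isLittleO.comp_tendsto hx).norm_right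
      exact this.tendsto_inv_smul_nhds_zero
    have h2 : Tendsto (fun k => A (U (σ k))) atTop (𝓝 (A u)) := (A.continuous.tendsto u).comp hlimU
    have h3 : Tendsto (fun k => (t k)⁻¹ • (z (σ k) - g (x (σ k)))) atTop (𝓝 0) := by
      refine squeeze_zero_norm (fun k => ?_) hδσ
      rw [norm_smul, norm_inv, Real.norm_of_nonneg (htpos k).le, norm_sub_rev,
        inv_mul_le_iff₀ (htpos k), mul_comm]
      exact hgzle (σ k)
    have h4 := (h1.add h2).add h3
    rw [zero_add, add_zero] at h4
    refine h4.congr fun k => ?_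
    have : A (U (σ k)) = (t k)⁻¹ • A (x (σ k) - x₀) := by rw [hU, map_smul]
    rw [this, ← smul_add, ← smul_add, hw]
    congr 1
    abel
  have hcone : A u ∈ VarAnalysis.contingentCone C (g x₀) :=
    ⟨t, w, htpos, ht0, hwlim, fun k => by rw [hzw]; exact hzC _⟩
  have hdir : lam ∈ VarAnalysis.directionalNormalCone C (g x₀) (A u) :=
    ⟨t, w, fun k => L (σ k), htpos, ht0, hwlim, hlimL, fun k => by
      rw [hzw]; exact ⟨hzC _, hreg _⟩⟩
  have hadj0 : ContinuousLinearMap.adjoint A lam = 0 := by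
    have h1 : Tendsto (fun k => ContinuousLinearMap.adjoint (fderiv ℝ g (x (σ k)))) atTop
        (𝓝 (ContinuousLinearMap.adjoint A)) :=
      (ContinuousLinearMap.adjoint.continuous.tendsto A).comp (hg.2.continuousAt.tendsto.comp hx)
    have h2 := VarAnalysis.tendsto_clm_apply h1 hlimL
    exact tendsto_nhds_unique h2 (squeeze_zero_norm (fun k => hadj (σ k)) hδσ)
  have hlam0 : lam = 0 := by
    refine hsecond u lam (by rintro rfl; simp at hu1) hcone hdir hadj0 ?_
    set φ : EuclideanSpace ℝ (Fin n) → ℝ := fun y => inner ℝ lam (g y) with hφ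
    set B := fderiv ℝ (fderiv ℝ φ) x₀ with hB
    have hinner : ∀ d, inner ℝ lam (A d) = 0 := fun d => by
      rw [← ContinuousLinearMap.adjoint_inner_left, hadj0, inner_zero_left]
    have hdφ : fderiv ℝ φ x₀ = 0 := by
      have h := (innerSL ℝ lam).hasFDerivAt.comp x₀ hg.1.self_of_nhds.hasFDerivAt
      refine h.fderiv.trans (ContinuousLinearMap.ext fun d => ?_)
      exact hinner d
    have htaylor := ((hg.const_inner lam).isLittleO_taylor.comp_tendsto hx).tendsto_div_nhds_zero
    have hquad : Tendsto (fun k => 1 / 2 * B (U (σ k)) (U (σ k))) atTop (𝓝 (1 / 2 * B u u)) :=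
      (VarAnalysis.tendsto_clm_apply ((B.continuous.tendsto u).comp hlimU) hlimU).const_mul _
    have hsum := htaylor.add hquad
    rw [zero_add] at hsum
    refine VarAnalysis.lowerCurvature_le_of_tendsto htpos ht0 hwlim hlimL (fun k => ?_) ?_ hsum
    · rw [hzw]
      exact VarAnalysis.regularNormalCone_subset_limitingNormalCone (hzC _) (hreg _)
    · have hpos1 : Tendsto (fun k => inner ℝ lam (L (σ k))) atTop (𝓝 (inner ℝ lam lam)) :=
        tendsto_const_nhds.inner hlimL
      rw [real_inner_self_eq_norm_sq, hlam1] at hpos1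
      -- Since `⟨lam, L (σ k)⟩ → 1`, the residual term is eventually nonnegative and can be dropped
      -- from the upper bound.
      filter_upwards [hpos1.eventually_const_lt (show (0 : ℝ) < 1 ^ 2 by norm_num)] with k hk
      have hnum : inner ℝ lam (w k - A u) = (t k)⁻¹ * (φ (x (σ k)) - φ x₀
          - ‖g (x (σ k)) - z (σ k)‖ * inner ℝ lam (L (σ k))) := by
        have h := congrArg (fun y => inner ℝ lam y) (hzL k)
        simp only [inner_sub_right, inner_smul_right] at h
        rw [inner_sub_right, hinner, sub_zero, hw, inner_smul_right, inner_sub_right]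
        congr 1
        linarith
      have hBt : B (x (σ k) - x₀) (x (σ k) - x₀) = t k ^ 2 * B (U (σ k)) (U (σ k)) := by
        rw [hxU]
        simp only [map_smul, smul_apply, smul_eq_mul]
        ring
      have hnn : 0 ≤ ‖g (x (σ k)) - z (σ k)‖ * inner ℝ lam (L (σ k)) := by positivity
      have htk := htpos k
      simp only [Function.comp_apply]
      change _ ≤ (φ (x (σ k)) - φ x₀ - fderiv ℝ φ x₀ (x (σ k) - x₀)
        - 1 / 2 * B (x (σ k) - x₀) (x (σ k) - x₀)) / t k ^ 2 + _
      rw [hnum, hBt, hdφ, zero_apply, sub_zero]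
      have e : (φ (x (σ k)) - φ x₀ - 1 / 2 * (t k ^ 2 * B (U (σ k)) (U (σ k)))) / t k ^ 2
          + 1 / 2 * B (U (σ k)) (U (σ k)) = (φ (x (σ k)) - φ x₀) / t k ^ 2 := by
        field_simp
        ring
      rw [e, inv_mul_eq_div, div_div, ← sq]
      exact div_le_div_of_nonneg_right (by linarith) (by positivity)
  simp [hlam0] at hlam1
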